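/- Let $k$ be a field and let $G=\mathrm{Spec}\,A$ be an affine group scheme over $k$ ($A$ a commutative Hopf algebra over $k$) that is linearly reductive, i.e. every linear representation of $G$ is completely reducible. Let $A^*=\mathrm{Hom}_k(A,k)$ be the dual algebra, with product $(f f')(a)=\sum f(a_{(1)})f'(a_{(2)})$, let $a\mapsto a^*$ be the antipode of $A$, that is, $a^*(g)=a(g^{-1})$, and let points $g\in G(R)=\mathrm{Hom}_{k\text{-alg}}(A,R)\subset \mathrm{Hom}_k(A,R)$ ($R$ a commutative $k$-algebra) act on functions by $(g\cdot a)(x)=a(xg)$, $(a\cdot g)(x)=a(gx)$, and on $\mathrm{Hom}_k(A,R)$ by left and right multiplication. Then: 1. There is a unique invariant integral $w_G=\int_G dg\in A^*$, i.e. a unique linear form with $w_G(1)=1$ and $g\cdot w_G=w_G$ for all points $g$ of $G$. There are finite-dimensional simple $k$-algebras $A_i^*$ and a linear isomorphism $A\cong\bigoplus_i A_i$, with $A_i$ the dual space of $A_i^*$, whose transpose is an isomorphism of $k$-algebras $A^*\cong\prod_i A_i^*$. 2. The Fourier transform $F\colon A\to A^*$, $F(a)=w_G(a^*\cdot -)$,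 is a morphism of left and right $G$-modules: after extension of scalars to any commutative $k$-algebra $R$, $F(g\cdot a)=g\cdot F(a)$ and $F(a\cdot g)=F(a)\cdot g$ for all $g\in G(R)$ and $a\in R\otimes_k A$. 3. For every decomposition as in 1, let $\mathrm{tr}=\sum_i \mathrm{tr}_{A_i^*}$ on $\tilde A=\bigoplus_i A_i^*\subseteq A^*$, where $\mathrm{tr}_{A_i^*}(b)$ is the trace of the endomorphism $b'\mapsto bb'$ of $A_i^*$, and let $\phi\colon \bigoplus_i A_i^*\to\bigoplus_i A_i=A$ be the polarity of the trace form, $\phi((b_i)_i)=(b'\mapsto \mathrm{tr}_{A_i^*}(b_ib'))_i$. Then $\phi$ is an isomorphism, $F$ takes its values in $\tilde A$, and $F=\phi^{-1}$. Moreover, for all $a,b\in A$, $F(a)F(b)\in\tilde A$ and $$\int_G a(g^{-1})\,b(g)\,dg:=w_G(a^*b)=\mathrm{tr}(F(a)F(b)).$$ 4. If $k$ is algebraically closed, the characters of the irreducible representations of $G$ are orthonormal: for irreducible $E,E'$, $w_G(\chi_E^*\,\chi_{E'})$ is $1$ if $E\cong E'$ and $0$ otherwise, where $\chi_E\in A$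 is the function $\chi_E(g)=$ trace of $g$ on $E$. -/

import Mathlib

open scoped TensorProduct DirectSum
open WithConv

universe u

noncomputable section

namespace AffineGroup

/-! Throughout, `G = Spec A` is an affine group scheme over the field `k`, i.e. `A` is a commutative
Hopf algebra over `k`, and `G(B) = (A →ₐ[k] B)` for a commutative `k`-algebra `B`. -/

section Representations

variable (k A : Type u) [Field k] [CommRing A] [HopfAlgebra k A]

/-- A linear representation of `G = Spec A` on the `k`-vector space `V`, given by its coaction
`V → V ⊗ A`, `v ↦ ∑ vᵢ ⊗ aᵢ`, so that `g • v = ∑ aᵢ(g) vᵢ`. -/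
structure LinRep (V : Type u) [AddCommGroup V] [Module k V] where
  coact : V →ₗ[k] V ⊗[k] A
  coassoc : (TensorProduct.assoc k V A A).toLinearMap ∘ₗ coact.rTensor A ∘ₗ coact =
    (Coalgebra.comul (R := k) (A := A)).lTensor V ∘ₗ coact
  counit : (TensorProduct.rid k V).toLinearMap ∘ₗ
    (Coalgebra.counit (R := k) (A := A)).lTensor V ∘ₗ coact = LinearMap.id

namespace LinRep

variable {k A}
variable {V V' : Type u} [AddCommGroup V] [Module k V] [AddCommGroup V'] [Module k V']

/-- The `B`-linear action of a point `g ∈ G(B)` on `B ⊗ V`. -/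
def act (ρ : LinRep k A V) {B : Type u} [CommRing B] [Algebra k B] (g : A →ₐ[k] B) :
    B ⊗[k] V →ₗ[B] B ⊗[k] V :=
  LinearMap.liftBaseChange B
    ((TensorProduct.comm k V B).toLinearMap ∘ₗ g.toLinearMap.lTensor V ∘ₗ ρ.coact)

/-- `W` is a subrepresentation: the coaction maps `W` into `W ⊗ A`. -/
def IsSubrep (ρ : LinRep k A V) (W : Submodule k V) : Prop :=
  ∀ v ∈ W, ρ.coact v ∈ LinearMap.range (W.subtype.rTensor A)

/-- Every subrepresentation has a complementary subrepresentation. -/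
def IsCompletelyReducible (ρ : LinRep k A V) : Prop :=
  ∀ W : Submodule k V, ρ.IsSubrep W → ∃ W' : Submodule k V, ρ.IsSubrep W' ∧ IsCompl W W'

/-- Nonzero, without subrepresentations other than `0` and `V`. -/
def IsIrreducible (ρ : LinRep k A V) : Prop :=
  Nontrivial V ∧ ∀ W : Submodule k V, ρ.IsSubrep W → W = ⊥ ∨ W = ⊤

/-- Isomorphism of representations. -/
def IsIso (ρ : LinRep k A V) (ρ' : LinRep k A V') : Prop :=
  ∃ e : V ≃ₗ[k] V', ρ'.coact ∘ₗ e.toLinearMap = e.toLinearMap.rTensor A ∘ₗ ρ.coact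

/-- The character `χ_V ∈ A` of a finite-dimensional representation: the function on `G` whose
value at `g` is the trace of `g`. It is the trace of the universal point `id ∈ G(A)`;
its value at an arbitrary point is computed in `apply_character`. -/
def character (ρ : LinRep k A V) : A :=
  LinearMap.trace A (A ⊗[k] V) (ρ.act (AlgHom.id k A))

theorem apply_character (ρ : LinRep k A V) [FiniteDimensional k V] {B : Type u} [CommRing B]
    [Algebra k B] (g : A →ₐ[k] B) :
    g ρ.character = LinearMap.trace B (B ⊗[k] V) (ρ.act g) := by
  classical
  let b := Module.finBasis k V
  have key : ∀ x : V ⊗[k] A, ∀ i,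
      g ((b.baseChange A).repr ((TensorProduct.comm k V A) x) i) =
        (b.baseChange B).repr ((TensorProduct.comm k V B) (g.toLinearMap.lTensor V x)) i := by
    intro x i
    induction x using TensorProduct.induction_on with
    | zero => simp
    | tmul v a => simp [Algebra.smul_def]
    | add x y hx hy => simp only [map_add, Finsupp.add_apply, hx, hy]
  rw [character, LinearMap.trace_eq_matrix_trace A (b.baseChange A),
    LinearMap.trace_eq_matrix_trace B (b.baseChange B), Matrix.trace, Matrix.trace, map_sum]
  refine Finset.sum_congr rfl fun i _ => ?_
  simp only [Matrix.diag_apply, LinearMap.toMatrix_apply, act, Module.Basis.baseChange_apply,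
    LinearMap.liftBaseChange_tmul, one_smul, LinearMap.comp_apply, LinearEquiv.coe_coe]
  rw [← key]
  simp

end LinRep

/-- `G = Spec A` is linearly reductive: every linear representation is completely reducible. -/
def IsLinearlyReductive : Prop :=
  ∀ (V : Type u) [AddCommGroup V] [Module k V] (ρ : LinRep k A V), ρ.IsCompletelyReducible

end Representations

section Fourier

/-- The algebra `A^*(B) = Hom_k(A, B)` with the convolution product
`(f * f')(a) = ∑ f(a₁) f'(a₂)`; for `B = k` this is the dual algebra `A^*`. -/
abbrev DualAlg (k A B : Type u) [Field k] [CommRing A] [HopfAlgebra k A] [CommRing B]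
    [Algebra k B] : Type u :=
  WithConv (A →ₗ[k] B)

variable {k A : Type u} [Field k] [CommRing A] [HopfAlgebra k A]

/-- A point `g ∈ G(B)` as an element of `A^*(B)`; multiplication by it is the action of `g`. -/
def point {B : Type u} [CommRing B] [Algebra k B] (g : A →ₐ[k] B) : DualAlg k A B :=
  toConv g.toLinearMap

/-- The image in `A^*(B)` of a form `w ∈ A^*`. -/
def extendForm (B : Type u) [CommRing B] [Algebra k B] (w : DualAlg k A k) : DualAlg k A B :=
  toConv (Algebra.linearMap k B ∘ₗ w.ofConv)

/-- `w` is the invariant integral on `G`: `w(1) = 1` and `g · w = w` for every point `g` of `G`. -/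
structure IsInvariantIntegral (w : DualAlg k A k) : Prop where
  normalized : w 1 = 1
  invariant : ∀ (B : Type u) [CommRing B] [Algebra k B] (g : A →ₐ[k] B),
    point g * extendForm B w = extendForm B w

/-- The left action of `g ∈ G(B)` on functions, `(g · a)(x) = a(x g)`. -/
def leftTranslate {B : Type u} [CommRing B] [Algebra k B] (g : A →ₐ[k] B) :
    B ⊗[k] A →ₗ[B] B ⊗[k] A :=
  LinearMap.liftBaseChange B ((TensorProduct.comm k A B).toLinearMap ∘ₗ
    g.toLinearMap.lTensor A ∘ₗ Coalgebra.comul)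

/-- The right action of `g ∈ G(B)` on functions, `(a · g)(x) = a(g x)`. -/
def rightTranslate {B : Type u} [CommRing B] [Algebra k B] (g : A →ₐ[k] B) :
    B ⊗[k] A →ₗ[B] B ⊗[k] A :=
  LinearMap.liftBaseChange B (g.toLinearMap.rTensor A ∘ₗ Coalgebra.comul)

/-- The metric `T²(a, b) = w(a^* b) = ∫ a(g⁻¹) b(g) dg` on `A`, where `a^*` is the image of `a`
under the antipode. -/
def metric (w : DualAlg k A k) : A →ₗ[k] A →ₗ[k] k :=
  ((LinearMap.mul k A).compr₂ w.ofConv) ∘ₗ HopfAlgebra.antipode k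

/-- The Fourier transform `F : A → A^*`, `F(a) = w(a^* · -)`. -/
def fourier (w : DualAlg k A k) : A →ₗ[k] DualAlg k A k :=
  (WithConv.linearEquiv k (A →ₗ[k] k)).symm.toLinearMap ∘ₗ metric w

/-- The `B`-linear extension `B ⊗ A → A^*(B)` of the Fourier transform. -/
def fourierExt (w : DualAlg k A k) (B : Type u) [CommRing B] [Algebra k B] (x : B ⊗[k] A) :
    DualAlg k A B :=
  toConv (LinearMap.liftBaseChange B
    ((Algebra.linearMap k B).compRight k ∘ₗ metric w) x)

end Fourier

section Trace

/-- The form `tr_B` on a finite `k`-algebra `B`: the trace of `b' ↦ b b'`. -/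
def regTrace (k B : Type u) [Field k] [Ring B] [Algebra k B] : B →ₗ[k] k :=
  LinearMap.trace k B ∘ₗ LinearMap.mul k B

/-- The polarity `B → B^*`, `b ↦ (b' ↦ tr_B(b b'))` of the metric of the trace. -/
def regPolarity (k B : Type u) [Field k] [Ring B] [Algebra k B] : B →ₗ[k] Module.Dual k B :=
  (LinearMap.mul k B).compr₂ (regTrace k B)

open scoped Classical in
/-- A decomposition `A^* = ∏ᵢ Bᵢ` of the dual algebra as a product of `k`-algebras, coming from a
decomposition `A = ⊕ᵢ Bᵢ^*`. -/
structure DualDecomposition (k A : Type u) [Field k] [CommRing A] [HopfAlgebra k A]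
    {ι : Type u} (B : ι → Type u) [∀ i, Ring (B i)] [∀ i, Algebra k (B i)] where
  decomp : A ≃ₗ[k] ⨁ i, Module.Dual k (B i)
  toPi : DualAlg k A k ≃ₐ[k] ∀ i, B i
  pairing : ∀ (f : DualAlg k A k) (a : A),
    f a = DirectSum.toModule k ι k (fun i => Module.Dual.eval k (B i) (toPi f i)) (decomp a)

namespace DualDecomposition

variable {k A : Type u} [Field k] [CommRing A] [HopfAlgebra k A] {ι : Type u} {B : ι → Type u}
  [∀ i, Ring (B i)] [∀ i, Algebra k (B i)]

/-- The inclusion of `⊕ᵢ Bᵢ` in `∏ᵢ Bᵢ = A^*`. -/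
def incl (D : DualDecomposition k A B) : (⨁ i, B i) →ₗ[k] DualAlg k A k :=
  D.toPi.symm.toLinearMap ∘ₗ DFinsupp.coeFnLinearMap k

open scoped Classical in
/-- The trace `tr = ∑ᵢ tr_{Bᵢ}` on `⊕ᵢ Bᵢ`. -/
def tr (_ : DualDecomposition k A B) : (⨁ i, B i) →ₗ[k] k :=
  DirectSum.toModule k ι k (fun i => regTrace k (B i))

/-- The polarity `φ : ⊕ᵢ Bᵢ → ⊕ᵢ Bᵢ^* = A` of the metric of the trace. -/
def polarity (D : DualDecomposition k A B) : (⨁ i, B i) →ₗ[k] A :=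
  D.decomp.symm.toLinearMap ∘ₗ DirectSum.lmap (fun i => regPolarity k (B i))

end DualDecomposition

end Trace

end AffineGroup

end

/-! Comodule theory over `A` is read as module theory over `A^*`: subrepresentations and morphisms
are detected by the `A^*`-action (`isSubrep_iff`, `coact_comp_eq`), and identities between
translations become associativity in `A^*`.

A complement of the constants in the regular representation yields a normalized right-invariant form
`v`. Its composite with the antipode is left-invariant, and for any left-invariant `w` the product
`v * w` equals both factors. So `w` is unique, two-sided invariant and fixed by the antipode. The
metric is therefore symmetric, and its invariance (`ract_fourier`) makes `F` commute with both
translations by `A^*`.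

Complete reducibility makes `A` a semisimple `A^*`-module whose endomorphisms are the right
translations. Its isotypic components are minimal subcoalgebras, finite-dimensional because orbits
are. Their duals are simple quotients of `A^*`, and `A^*` is the product of these.

`F ∘ φ = id` rests on `∑ a₁^* a₂ = ε(a)`. For a basis `eⱼ` of a block with dual basis `cⱼ`, it shows
that `∑ eⱼ F(cⱼ)` is the unit of the block (`sum_mul_fourier`). Since `φ(b) = ∑ (eⱼ · cⱼ) · b`,
equivariance gives `F(φ(b)) = b`. The same identity computes the trace of the intertwiners to which
Schur's lemma is applied for characters. -/

noncomputable section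

namespace AffineGroup

/-! ### The antipode as inversion in convolution groups. -/

section Antipode

variable {k A : Type u} [Field k] [CommRing A] [HopfAlgebra k A]

theorem antipode_antipode (a : A) : HopfAlgebra.antipode k (HopfAlgebra.antipode k a) = a := by
  have h := inv_inv (toConv (AlgHom.id k A))
  exact DFunLike.congr_fun (congrArg WithConv.ofConv h) a

/-- In the convolution group of algebra maps `A → A ⊗ A`, the comultiplication is the product of the
two inclusions; inverting it reverses the factors. -/
theorem comul_antipode (a : A) :
    Coalgebra.comul (R := k) (HopfAlgebra.antipode k a) =
      TensorProduct.map (HopfAlgebra.antipode k) (HopfAlgebra.antipode k)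
        (TensorProduct.comm k A A (Coalgebra.comul a)) := by
  have hcomul : toConv (Algebra.TensorProduct.includeLeft (R := k) (S := k) (A := A) (B := A)) *
      toConv (Algebra.TensorProduct.includeRight (R := k) (A := A) (B := A)) =
      toConv (Bialgebra.comulAlgHom k A) := by
    apply WithConv.ext
    ext x
    rw [AlgHom.convMul_apply]
    change _ = Coalgebra.comul x
    generalize Coalgebra.comul (R := k) x = y
    induction y using TensorProduct.induction_on with
    | zero => simp
    | tmul a b => simp
    | add x y hx hy => simp only [map_add, hx, hy]
  have h := DFunLike.congr_fun (congrArg WithConv.ofConv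
    ((mul_inv_rev (toConv (Algebra.TensorProduct.includeLeft (R := k) (S := k) (A := A) (B := A)))
      (toConv (Algebra.TensorProduct.includeRight (R := k) (A := A) (B := A)))).symm.trans
        (congrArg (·⁻¹) hcomul))) a
  refine (Eq.trans ?_ h).symm
  rw [AlgHom.convMul_apply]
  generalize Coalgebra.comul (R := k) a = y
  induction y using TensorProduct.induction_on with
  | zero => simp
  | tmul a b =>
    change HopfAlgebra.antipode k b ⊗ₜ[k] HopfAlgebra.antipode k a =
      ((1 : A) ⊗ₜ[k] HopfAlgebra.antipode k a) * (HopfAlgebra.antipode k b ⊗ₜ[k] (1 : A))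
    simp
  | add x y hx hy => simp only [map_add, hx, hy]

end Antipode

/-! ### Representations as modules over the dual algebra. -/

section DualAction

variable {k A : Type u} [Field k] [CommRing A] [HopfAlgebra k A]

namespace LinRep

variable {V V' : Type u} [AddCommGroup V] [Module k V] [AddCommGroup V'] [Module k V']

/-- The action of the dual algebra on a representation, `f • v = ∑ f(aᵢ) vᵢ`. -/
def dualAct (ρ : LinRep k A V) : DualAlg k A k →ₐ[k] Module.End k V :=
  AlgHom.ofLinearMap
    { toFun f := (TensorProduct.rid k V).toLinearMap ∘ₗ f.ofConv.lTensor V ∘ₗ ρ.coact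
      map_add' f g := by ext; simp [LinearMap.lTensor_add]
      map_smul' c f := by ext; simp [LinearMap.lTensor_smul] }
    (by
      exact ρ.counit)
    (fun f g => by
      have key : ∀ x : V ⊗[k] A,
          TensorProduct.rid k V (f.ofConv.lTensor V
            (ρ.coact (TensorProduct.rid k V (g.ofConv.lTensor V x)))) =
          TensorProduct.rid k V ((LinearMap.mul' k k ∘ₗ
            TensorProduct.map f.ofConv g.ofConv).lTensor V
              (TensorProduct.assoc k V A A (ρ.coact.rTensor A x))) := by
        intro x
        induction x using TensorProduct.induction_on with
        | zero => simp
        | add x y hx hy => simp only [map_add, hx, hy]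
        | tmul v b =>
          simp only [LinearMap.lTensor_tmul, TensorProduct.rid_tmul, map_smul,
            LinearMap.rTensor_tmul]
          generalize ρ.coact v = y
          induction y using TensorProduct.induction_on with
          | zero => simp
          | add x y hx hy => simp only [map_add, smul_add, TensorProduct.add_tmul, hx, hy]
          | tmul v a => simp [smul_smul, mul_comm]
      ext v
      have hv := DFunLike.congr_fun ρ.coassoc v
      simp only [LinearMap.comp_apply, LinearEquiv.coe_coe] at hv
      refine Eq.trans ?_ (key _).symm
      rw [hv, ← LinearMap.lTensor_comp_apply]
      rfl)

theorem dualAct_apply (ρ : LinRep k A V) (f : DualAlg k A k) (v : V) :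
    ρ.dualAct f v = TensorProduct.rid k V (f.ofConv.lTensor V (ρ.coact v)) := rfl

theorem tensor_ext {V : Type u} [AddCommGroup V] [Module k V] {x y : V ⊗[k] A}
    (h : ∀ f : A →ₗ[k] k, TensorProduct.rid k V (f.lTensor V x) =
      TensorProduct.rid k V (f.lTensor V y)) : x = y := by
  classical
  let b := Module.Basis.ofVectorSpace k A
  apply (TensorProduct.equivFinsuppOfBasisRight b).injective
  ext i
  have := h (b.coord i)
  simpa [TensorProduct.equivFinsuppOfBasisRight_apply] using this

/-- By right exactness, membership means vanishing in `(V ⧸ W) ⊗ A`, which forms on `A` detect by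
`tensor_ext`. -/
theorem mem_range_rTensor {V : Type u} [AddCommGroup V] [Module k V] {W : Submodule k V}
    {x : V ⊗[k] A} :
    x ∈ LinearMap.range (W.subtype.rTensor A) ↔
      ∀ f : A →ₗ[k] k, TensorProduct.rid k V (f.lTensor V x) ∈ W := by
  constructor
  · rintro ⟨y, rfl⟩ f
    induction y using TensorProduct.induction_on with
    | zero => simp
    | add x y hx hy => simpa only [map_add] using W.add_mem hx hy
    | tmul w a => simpa using W.smul_mem _ w.2
  · intro h
    have hex := rTensor_exact A (LinearMap.exact_subtype_mkQ W) W.mkQ_surjective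
    refine (hex x).1 (tensor_ext fun f => ?_)
    have : TensorProduct.rid k (V ⧸ W) (f.lTensor (V ⧸ W) (W.mkQ.rTensor A x)) =
        W.mkQ (TensorProduct.rid k V (f.lTensor V x)) := by
      generalize x = x
      induction x using TensorProduct.induction_on with
      | zero => simp
      | add x y hx hy => simp only [map_add, hx, hy]
      | tmul w a => simp
    rw [this, map_zero, map_zero]
    simpa using h f

theorem isSubrep_iff (ρ : LinRep k A V) (W : Submodule k V) :
    ρ.IsSubrep W ↔ ∀ f, ∀ v ∈ W, ρ.dualAct f v ∈ W := by
  simp only [IsSubrep, mem_range_rTensor, dualAct_apply]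
  exact ⟨fun h f v hv => h v hv f.ofConv, fun h v hv f => h (toConv f) v hv⟩

theorem coact_comp_eq (ρ : LinRep k A V) (ρ' : LinRep k A V') (e : V →ₗ[k] V')
    (h : ∀ f v, e (ρ.dualAct f v) = ρ'.dualAct f (e v)) :
    ρ'.coact ∘ₗ e = e.rTensor A ∘ₗ ρ.coact := by
  ext v
  refine tensor_ext fun f => ?_
  refine (h (toConv f) v).symm.trans ?_
  rw [dualAct_apply, LinearMap.comp_apply]
  generalize ρ.coact v = x
  induction x using TensorProduct.induction_on with
  | zero => simp
  | add x y hx hy => simp only [map_add, hx, hy]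
  | tmul w a => simp

/-- Orbits of the dual algebra are finite-dimensional. -/
theorem exists_finiteDimensional_orbit (ρ : LinRep k A V) (v : V) :
    ∃ U : Submodule k V, FiniteDimensional k U ∧ ∀ f, ρ.dualAct f v ∈ U := by
  classical
  obtain ⟨s, hs⟩ := TensorProduct.exists_finset (R := k) (ρ.coact v)
  refine ⟨Submodule.span k (s.image Prod.fst : Finset V),
    FiniteDimensional.span_finset k _, fun f => ?_⟩
  rw [dualAct_apply, hs, map_sum, map_sum]
  refine Submodule.sum_mem _ fun i hi => ?_
  rw [LinearMap.lTensor_tmul, TensorProduct.rid_tmul]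
  exact Submodule.smul_mem _ _ (Submodule.subset_span (Finset.mem_coe.2
    (Finset.mem_image_of_mem _ hi)))

end LinRep

variable (k A) in
/-- The regular representation `(g • a)(x) = a(x g)`. -/
def regular : LinRep k A A where
  coact := Coalgebra.comul
  coassoc := Coalgebra.coassoc
  counit := by
    rw [Coalgebra.lTensor_counit_comp_comul]
    ext; simp

/-- The left translation `f • a = ∑ a₁ f(a₂)`. -/
abbrev lact : DualAlg k A k →ₐ[k] Module.End k A := (regular k A).dualAct

theorem lact_apply (f : DualAlg k A k) (a : A) :
    lact f a = TensorProduct.rid k A (f.ofConv.lTensor A (Coalgebra.comul a)) := rfl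

/-- The right translation `a • f = ∑ f(a₁) a₂`. -/
def ract : DualAlg k A k →ₗ[k] Module.End k A where
  toFun f := (TensorProduct.lid k A).toLinearMap ∘ₗ f.ofConv.rTensor A ∘ₗ Coalgebra.comul
  map_add' f g := by ext; simp [LinearMap.rTensor_add]
  map_smul' c f := by ext; simp [LinearMap.rTensor_smul]

theorem ract_apply (f : DualAlg k A k) (a : A) :
    ract f a = TensorProduct.lid k A (f.ofConv.rTensor A (Coalgebra.comul a)) := rfl

/-- Translations are transposes of multiplications in `A^*`; with `dual_ext`, this reduces their
identities to the ring axioms of `A^*`. -/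
theorem apply_lact (f g : DualAlg k A k) (a : A) : f (lact g a) = (f * g) a := by
  rw [lact_apply, LinearMap.convMul_apply]
  generalize Coalgebra.comul (R := k) a = x
  induction x using TensorProduct.induction_on with
  | zero => simp
  | add x y hx hy => simp only [map_add, hx, hy]
  | tmul w a => simp [mul_comm]

theorem apply_ract (f g : DualAlg k A k) (a : A) : f (ract g a) = (g * f) a := by
  rw [ract_apply, LinearMap.convMul_apply]
  generalize Coalgebra.comul (R := k) a = x
  induction x using TensorProduct.induction_on with
  | zero => simp
  | add x y hx hy => simp only [map_add, hx, hy]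
  | tmul w a => simp

theorem dual_ext {a b : A} (h : ∀ f : DualAlg k A k, f a = f b) : a = b :=
  Module.forall_dual_apply_eq_zero_iff k (a - b) |>.1
    (fun f => by rw [map_sub, sub_eq_zero]; exact h (toConv f)) |> sub_eq_zero.1

theorem counit_lact (f : DualAlg k A k) (a : A) : Coalgebra.counit (R := k) (lact f a) = f a :=
  (apply_lact 1 f a).trans (by rw [one_mul])

theorem counit_ract (f : DualAlg k A k) (a : A) : Coalgebra.counit (R := k) (ract f a) = f a :=
  (apply_ract 1 f a).trans (by rw [mul_one])

theorem lact_ract (f g : DualAlg k A k) (a : A) : lact f (ract g a) = ract g (lact f a) := by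
  refine dual_ext (k := k) fun h => ?_
  rw [apply_lact, apply_ract, apply_ract, apply_lact, mul_assoc]

theorem ract_ract (f g : DualAlg k A k) (a : A) : ract f (ract g a) = ract (g * f) a := by
  refine dual_ext (k := k) fun h => ?_
  rw [apply_ract, apply_ract, apply_ract, mul_assoc]

theorem ract_one (a : A) : ract (1 : DualAlg k A k) a = a := by
  refine dual_ext (k := k) fun h => ?_
  rw [apply_ract, one_mul]

theorem comul_ract (f : DualAlg k A k) (a : A) :
    Coalgebra.comul (R := k) (ract f a) = (ract f).rTensor A (Coalgebra.comul a) :=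
  DFunLike.congr_fun ((regular k A).coact_comp_eq (regular k A) (ract f)
    fun g v => (lact_ract g f v).symm) a

/-- Elements of `A` lie in finite-dimensional subcoalgebras. -/
theorem exists_finiteDimensional_biorbit (a : A) :
    ∃ U : Submodule k A, FiniteDimensional k U ∧
      ∀ f g : DualAlg k A k, lact f (ract g a) ∈ U := by
  classical
  obtain ⟨s, hs⟩ := TensorProduct.exists_finset (R := k) (Coalgebra.comul (R := k) a)
  choose U hU h using fun x : A => (regular k A).exists_finiteDimensional_orbit x
  refine ⟨s.sup fun i => U i.2, Submodule.finiteDimensional_finset_sup _ _, fun f g => ?_⟩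
  rw [ract_apply, hs, map_sum, map_sum, map_sum]
  refine Submodule.sum_mem _ fun i hi => ?_
  rw [LinearMap.rTensor_tmul, TensorProduct.lid_tmul, map_smul]
  exact Submodule.smul_mem _ _ (Finset.le_sup (f := fun i : A × A => U i.2) hi (h _ _))

end DualAction

/-! ### The invariant integral and the equivariance of the Fourier transform. -/

section Integral

variable {k A : Type u} [Field k] [CommRing A] [HopfAlgebra k A]

theorem lact_antipode (f : DualAlg k A k) (a : A) :
    lact f (HopfAlgebra.antipode k a) =
      HopfAlgebra.antipode k (ract (toConv (f.ofConv ∘ₗ HopfAlgebra.antipode k)) a) := by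
  rw [lact_apply, ract_apply, comul_antipode]
  generalize Coalgebra.comul (R := k) a = x
  induction x using TensorProduct.induction_on with
  | zero => simp
  | add x y hx hy => simp only [map_add, hx, hy]
  | tmul w a => simp

/-- This is invariance at the universal point `id ∈ G(A)`. -/
theorem lact_eq_smul_one {w : DualAlg k A k} (hw : IsInvariantIntegral w) (a : A) :
    lact w a = w a • (1 : A) := by
  have h := DFunLike.congr_fun (congrArg WithConv.ofConv (hw.invariant A (AlgHom.id k A))) a
  rw [← Algebra.algebraMap_eq_smul_one]
  refine Eq.trans ?_ h
  change _ = (point (AlgHom.id k A) * extendForm A w) a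
  rw [lact_apply, LinearMap.convMul_apply]
  generalize Coalgebra.comul (R := k) a = x
  induction x using TensorProduct.induction_on with
  | zero => simp
  | add x y hx hy => simp only [map_add, hx, hy]
  | tmul w a => simp [point, extendForm, Algebra.smul_def, mul_comm]

/-- Invariance under the dual algebra implies invariance under all points. -/
theorem isInvariantIntegral_of_lact {w : DualAlg k A k} (h1 : w 1 = 1)
    (h : ∀ a, lact w a = w a • (1 : A)) : IsInvariantIntegral w where
  normalized := h1
  invariant B _ _ g := by
    ext a
    refine Eq.trans ?_ (congrArg g (h a)) |>.trans ?_
    · change (point g * extendForm B w) a = _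
      rw [lact_apply, LinearMap.convMul_apply]
      generalize Coalgebra.comul (R := k) a = x
      induction x using TensorProduct.induction_on with
      | zero => simp
      | add x y hx hy => simp only [map_add, hx, hy]
      | tmul w a => simp [point, extendForm, Algebra.smul_def, mul_comm]
    · simp [extendForm, Algebra.algebraMap_eq_smul_one]

/-- The form is the projection `p` onto the constants along a stable complement `W`. Stability gives
`p * f = f(1) p` for every `f`, which is right invariance. -/
theorem exists_right_invariant (hG : IsLinearlyReductive k A) :
    ∃ w : DualAlg k A k, w 1 = 1 ∧ ∀ a, ract w a = w a • (1 : A) := by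
  have hsub : (regular k A).IsSubrep (k ∙ (1 : A)) := by
    rw [LinRep.isSubrep_iff]
    intro f v hv
    obtain ⟨c, rfl⟩ := Submodule.mem_span_singleton.1 hv
    rw [map_smul]
    refine Submodule.smul_mem _ _ (Submodule.mem_span_singleton.2 ⟨f 1, ?_⟩)
    rw [lact_apply]
    simp [Algebra.TensorProduct.one_def]
  obtain ⟨W, hW, hc⟩ := hG A (regular k A) _ hsub
  rw [LinRep.isSubrep_iff] at hW
  have h10 : (1 : A) ≠ 0 := fun h => by
    have := congrArg (Coalgebra.counit (R := k)) h
    simp at this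
  let p : A →ₗ[k] k := (LinearEquiv.toSpanNonzeroSingleton k A 1 h10).symm.toLinearMap ∘ₗ
    Submodule.projectionOnto _ _ hc
  have hp1 : ∀ x, p x • (1 : A) = Submodule.projectionOnto _ _ hc x := fun x => by
    have := (LinearEquiv.toSpanNonzeroSingleton k A 1 h10).apply_symm_apply
      (Submodule.projectionOnto _ _ hc x)
    exact congrArg Subtype.val this
  have hpW : ∀ x ∈ W, p x = 0 := fun x hx => by
    have : Submodule.projectionOnto _ _ hc x = 0 := by simpa using hx
    simp [p, this]
  have hp : p 1 = 1 := by
    have h := hp1 1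
    rw [Submodule.projectionOnto_apply_left hc ⟨1, Submodule.mem_span_singleton_self 1⟩] at h
    have := congrArg (Coalgebra.counit (R := k)) h
    simpa using this
  refine ⟨toConv p, hp, fun a => ?_⟩
  refine dual_ext (k := k) fun f => ?_
  rw [apply_ract, ← apply_lact]
  -- Splitting off the constant part of `a` leaves an element whose translates all stay in the
  -- kernel of `p`.
  have ha : a - p a • (1 : A) ∈ W := by
    have : Submodule.projectionOnto _ _ hc (a - p a • (1 : A)) = 0 := by
      have h1 : Submodule.projectionOnto _ _ hc (1 : A) =
          ⟨1, Submodule.mem_span_singleton_self 1⟩ :=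
        Submodule.projectionOnto_apply_left hc ⟨1, Submodule.mem_span_singleton_self 1⟩
      rw [map_sub, map_smul, h1, sub_eq_zero]
      exact Subtype.ext (hp1 a).symm
    exact (Submodule.projectionOnto_apply_eq_zero_iff hc).1 this
  have h0 := hpW _ (hW f _ ha)
  have hl1 : lact f (1 : A) = f 1 • (1 : A) := by
    rw [lact_apply]
    simp [Algebra.TensorProduct.one_def]
  change p (lact f a) = f (p a • (1 : A))
  rw [map_sub, map_sub, sub_eq_zero] at h0
  rw [h0, map_smul, map_smul, map_smul]
  change p a • p (lact f (1 : A)) = _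
  rw [hl1, map_smul, hp]
  simp

/-- The product `v * w` is `w` by left invariance of `w` and `v` by right invariance of `v`. -/
theorem eq_of_right_invariant {w v : DualAlg k A k} (hw : IsInvariantIntegral w)
    (hv1 : v 1 = 1) (hv : ∀ a, ract v a = v a • (1 : A)) : w = v := by
  ext a
  have h1 : (v * w) a = w a := by
    rw [← apply_lact, lact_eq_smul_one hw, map_smul]; simp [hv1]
  have h2 : (v * w) a = v a := by
    rw [← apply_ract, hv, map_smul]; simp [hw.normalized]
  exact h1.symm.trans h2

theorem isInvariantIntegral_comp_antipode {v : DualAlg k A k} (hv1 : v 1 = 1)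
    (hv : ∀ a, ract v a = v a • (1 : A)) :
    IsInvariantIntegral (toConv (v.ofConv ∘ₗ HopfAlgebra.antipode k)) :=
  isInvariantIntegral_of_lact (by simp [hv1]) fun a => by
    rw [← antipode_antipode (k := k) a, lact_antipode]
    have : toConv ((v.ofConv ∘ₗ HopfAlgebra.antipode k) ∘ₗ HopfAlgebra.antipode k) = v := by
      ext; simp [antipode_antipode]
    change HopfAlgebra.antipode k (ract (toConv ((v.ofConv ∘ₗ HopfAlgebra.antipode k) ∘ₗ
      HopfAlgebra.antipode k)) _) = _
    rw [this, hv, map_smul, HopfAlgebra.antipode_one]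
    simp [antipode_antipode]

theorem existsUnique_integral (hG : IsLinearlyReductive k A) :
    ∃! w : DualAlg k A k, IsInvariantIntegral w := by
  obtain ⟨v, hv1, hv⟩ := exists_right_invariant hG
  have hS := isInvariantIntegral_comp_antipode hv1 hv
  exact ⟨_, hS, fun w hw =>
    (eq_of_right_invariant hw hv1 hv).trans (eq_of_right_invariant hS hv1 hv).symm⟩

theorem apply_antipode (hG : IsLinearlyReductive k A) {w : DualAlg k A k}
    (hw : IsInvariantIntegral w) (a : A) : w (HopfAlgebra.antipode k a) = w a := by
  obtain ⟨v, hv1, hv⟩ := exists_right_invariant hG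
  have h := (eq_of_right_invariant hw hv1 hv).trans
    (eq_of_right_invariant (isInvariantIntegral_comp_antipode hv1 hv) hv1 hv).symm
  rw [eq_of_right_invariant hw hv1 hv] at h ⊢
  exact (DFunLike.congr_fun (congrArg WithConv.ofConv h) a).symm

theorem fourier_apply (w : DualAlg k A k) (a b : A) :
    fourier w a b = w (HopfAlgebra.antipode k a * b) := rfl

theorem fourier_symm (hG : IsLinearlyReductive k A) {w : DualAlg k A k}
    (hw : IsInvariantIntegral w) (a b : A) : fourier w a b = fourier w b a := by
  rw [fourier_apply, fourier_apply, ← apply_antipode hG hw, HopfAlgebra.antipode_mul_distrib,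
    antipode_antipode, mul_comm]

/-- The identity `∑ w(b^* a₁) a₂ = ∑ w(a^* b₂) b₁`, expressing the invariance of the metric. -/
theorem ract_fourier (hG : IsLinearlyReductive k A) {w : DualAlg k A k}
    (hw : IsInvariantIntegral w) (a b : A) :
    ract (fourier w b) a = lact (fourier w a) b := by
  obtain ⟨s, hs⟩ := TensorProduct.exists_finset (R := k) (Coalgebra.comul (R := k) b)
  let H : A → DualAlg k A A := fun b => extendForm A (fourier w b)
  -- Invariance of `w` at `x^* b` reads `∑ x₂^* b₁ w(x₁^* b₂) = w(x^* b)`; by symmetry of the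
  -- metric, `H c` is the map `x ↦ w(x^* c)`.
  have inv : ∑ i ∈ s, i.1 • (H i.2 * toConv (HopfAlgebra.antipode k)) = H b := by
    ext x
    have h := lact_eq_smul_one hw (HopfAlgebra.antipode k x * b)
    rw [← fourier_apply, fourier_symm hG hw, ← Algebra.algebraMap_eq_smul_one] at h
    refine Eq.trans ?_ h
    rw [lact_apply, Bialgebra.comul_mul, comul_antipode, hs, ofConv_sum, LinearMap.sum_apply]
    simp only [Finset.mul_sum, map_sum]
    refine Finset.sum_congr rfl fun i _ => ?_
    rw [ofConv_smul, LinearMap.smul_apply, LinearMap.convMul_apply]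
    generalize Coalgebra.comul (R := k) x = y
    induction y using TensorProduct.induction_on with
    | zero => simp
    | add x y hx hy => simp only [map_add, smul_add, add_mul, hx, hy]
    | tmul y z =>
      have : H i.2 y = algebraMap k A (w (HopfAlgebra.antipode k y * i.2)) := by
        rw [← fourier_apply, fourier_symm hG hw]; rfl
      simp [this, Algebra.smul_def]
      ring
  -- Convolving with the identity on the right cancels the antipode and leaves `∑ b₁ H(b₂) = H(b) *
  -- id`, to be evaluated at `a`.
  have h := congrArg (· * toConv LinearMap.id) inv
  simp only [Finset.sum_mul, smul_mul_assoc, mul_assoc, LinearMap.antipode_mul_id, mul_one] at h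
  have h' := DFunLike.congr_fun (congrArg WithConv.ofConv h) a
  refine Eq.trans ?_ (h'.symm.trans ?_)
  · rw [ract_apply, LinearMap.convMul_apply]
    generalize Coalgebra.comul (R := k) a = y
    induction y using TensorProduct.induction_on with
    | zero => simp
    | add x y hx hy => simp only [map_add, hx, hy]
    | tmul y z => simp [H, extendForm, Algebra.smul_def]
  · rw [lact_apply, hs, ofConv_sum, LinearMap.sum_apply]
    simp only [map_sum]
    refine Finset.sum_congr rfl fun i _ => ?_
    have : H i.2 a = algebraMap k A (fourier w a i.2) := by rw [fourier_symm hG hw]; rfl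
    rw [ofConv_smul, LinearMap.smul_apply, this]
    simp [Algebra.smul_def, mul_comm]

theorem fourier_lact (hG : IsLinearlyReductive k A) {w : DualAlg k A k}
    (hw : IsInvariantIntegral w) (f : DualAlg k A k) (a : A) :
    fourier w (lact f a) = f * fourier w a := by
  ext b
  change fourier w (lact f a) b = (f * fourier w a) b
  rw [fourier_symm hG hw, apply_lact, ← apply_ract, ract_fourier hG hw, apply_lact]

theorem fourier_ract (hG : IsLinearlyReductive k A) {w : DualAlg k A k}
    (hw : IsInvariantIntegral w) (f : DualAlg k A k) (a : A) :
    fourier w (ract f a) = fourier w a * f := by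
  ext b
  change fourier w (ract f a) b = (fourier w a * f) b
  rw [fourier_symm hG hw, apply_ract, ← apply_lact, ← ract_fourier hG hw, apply_ract]

section Points

variable {R : Type u} [CommRing R] [Algebra k R]

theorem fourierExt_tmul_apply (w : DualAlg k A k) (r : R) (a b : A) :
    fourierExt w R (r ⊗ₜ a) b = r * algebraMap k R (fourier w a b) := rfl

theorem fourierExt_add (w : DualAlg k A k) (x y : R ⊗[k] A) :
    fourierExt w R (x + y) = fourierExt w R x + fourierExt w R y := by
  ext; simp [fourierExt]

theorem fourierExt_smul (w : DualAlg k A k) (r : R) (x : R ⊗[k] A) :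
    fourierExt w R (r • x) = r • fourierExt w R x := by
  ext; simp [fourierExt]

theorem fourierExt_zero (w : DualAlg k A k) : fourierExt w R (0 : R ⊗[k] A) = 0 := by
  ext; simp [fourierExt]

theorem fourierExt_leftTranslate (hG : IsLinearlyReductive k A) {w : DualAlg k A k}
    (hw : IsInvariantIntegral w) (g : A →ₐ[k] R) (x : R ⊗[k] A) :
    fourierExt w R (leftTranslate g x) = point g * fourierExt w R x := by
  induction x using TensorProduct.induction_on with
  | zero => simp [fourierExt_zero]
  | add x y hx hy => simp only [map_add, fourierExt_add, mul_add, hx, hy]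
  | tmul r a =>
    ext b
    -- Evaluated at `b`, the two sides of the goal are `r` times the images under `g` of the two
    -- sides of `ract_fourier`.
    have h := congrArg (fun x => r * g x) (ract_fourier hG hw a b)
    refine Eq.trans ?_ (h.trans ?_)
    · rw [leftTranslate, LinearMap.liftBaseChange_tmul, fourierExt_smul, ract_apply]
      change r * fourierExt w R (TensorProduct.comm k A R
        (g.toLinearMap.lTensor A (Coalgebra.comul a))) b = _
      congr 1
      generalize Coalgebra.comul (R := k) a = y
      induction y using TensorProduct.induction_on with
      | zero => simp [fourierExt_zero]
      | add x y hx hy =>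
        simp only [map_add, fourierExt_add, ofConv_add, LinearMap.add_apply, hx, hy]
      | tmul u v =>
        rw [LinearMap.lTensor_tmul, TensorProduct.comm_tmul, fourierExt_tmul_apply,
          fourier_symm hG hw]
        simp [Algebra.smul_def, mul_comm]
    · rw [lact_apply, LinearMap.convMul_apply]
      generalize Coalgebra.comul (R := k) b = y
      induction y using TensorProduct.induction_on with
      | zero => simp
      | add x y hx hy => simp only [map_add, mul_add, hx, hy]
      | tmul u v =>
        rw [TensorProduct.map_tmul, LinearMap.mul'_apply, fourierExt_tmul_apply]
        simp [point, Algebra.smul_def]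
        ring

theorem fourierExt_rightTranslate (hG : IsLinearlyReductive k A) {w : DualAlg k A k}
    (hw : IsInvariantIntegral w) (g : A →ₐ[k] R) (x : R ⊗[k] A) :
    fourierExt w R (rightTranslate g x) = fourierExt w R x * point g := by
  induction x using TensorProduct.induction_on with
  | zero => simp [fourierExt_zero]
  | add x y hx hy => simp only [map_add, fourierExt_add, add_mul, hx, hy]
  | tmul r a =>
    ext b
    have h := congrArg (fun x => r * g x) (ract_fourier hG hw b a).symm
    refine Eq.trans ?_ (h.trans ?_)
    · rw [rightTranslate, LinearMap.liftBaseChange_tmul, fourierExt_smul, lact_apply]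
      change r * fourierExt w R (g.toLinearMap.rTensor A (Coalgebra.comul a)) b = _
      congr 1
      generalize Coalgebra.comul (R := k) a = y
      induction y using TensorProduct.induction_on with
      | zero => simp [fourierExt_zero]
      | add x y hx hy =>
        simp only [map_add, fourierExt_add, ofConv_add, LinearMap.add_apply, hx, hy]
      | tmul u v =>
        rw [LinearMap.rTensor_tmul, fourierExt_tmul_apply, fourier_symm hG hw]
        simp [Algebra.smul_def, mul_comm]
    · rw [ract_apply, LinearMap.convMul_apply]
      generalize Coalgebra.comul (R := k) b = y
      induction y using TensorProduct.induction_on with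
      | zero => simp
      | add x y hx hy => simp only [map_add, mul_add, hx, hy]
      | tmul u v =>
        rw [TensorProduct.map_tmul, LinearMap.mul'_apply, fourierExt_tmul_apply]
        simp [point, Algebra.smul_def]
        ring

end Points

end Integral

/-! ### Schur orthogonality, inversion of the polarity, Parseval's identity. -/

section Parseval

variable {k A : Type u} [Field k] [CommRing A] [HopfAlgebra k A]

/-- This is the antipode axiom `∑ a₁^* a₂ = ε(a)`, integrated. -/
theorem lift_metric_comul (w : DualAlg k A k) (a : A) :
    TensorProduct.lift (metric w) (Coalgebra.comul a) = Coalgebra.counit (R := k) a * w 1 := by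
  have h := congrArg w.ofConv (HopfAlgebra.mul_antipode_rTensor_comul_apply (R := k) a)
  rw [Algebra.algebraMap_eq_smul_one, map_smul] at h
  refine Eq.trans ?_ h
  generalize Coalgebra.comul (R := k) a = x
  induction x using TensorProduct.induction_on with
  | zero => simp
  | add x y hx hy => simp only [map_add, hx, hy]
  | tmul u v => rfl

/-- Schur orthogonality: if `∑ Eⱼ(x) cⱼ = x · f` for all `x`, then `∑ Eⱼ * F(cⱼ) = f`. -/
theorem sum_mul_fourier {w : DualAlg k A k} (hw : w 1 = 1) {J : Type*} [Fintype J]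
    (E : J → DualAlg k A k) (c : J → A) (f : DualAlg k A k)
    (h : ∀ x, ∑ j, E j x • c j = ract f x) : ∑ j, E j * fourier w (c j) = f := by
  ext a
  -- Since `ε(a · f) = f(a)` and `Δ(a · f) = ∑ (a₁ · f) ⊗ a₂`, expanding `a₁ · f` by the hypothesis
  -- produces the convolutions `Eⱼ * F(cⱼ)`.
  have h1 := lift_metric_comul w (ract f a)
  rw [counit_ract, hw, mul_one] at h1
  refine Eq.trans ?_ h1
  rw [comul_ract, ofConv_sum, LinearMap.sum_apply]
  simp only [LinearMap.convMul_apply]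
  generalize Coalgebra.comul (R := k) a = x
  induction x using TensorProduct.induction_on with
  | zero => simp
  | add x y hx hy => simp only [map_add, Finset.sum_add_distrib, hx, hy]
  | tmul u v =>
    rw [LinearMap.rTensor_tmul, ← h]
    simp only [TensorProduct.lift.tmul, map_sum, map_smul, LinearMap.sum_apply,
      LinearMap.smul_apply]
    rfl

theorem regTrace_mul_eq_sum {B : Type u} [Ring B] [Algebra k B] {J : Type*} [Fintype J]
    (e : Module.Basis J k B) (a b : B) :
    regTrace k B (a * b) = ∑ j, e.coord j (a * b * e j) := by
  classical
  rw [regTrace, LinearMap.comp_apply, LinearMap.trace_eq_matrix_trace k e, Matrix.trace]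
  simp [LinearMap.toMatrix_apply]

namespace DualDecomposition

variable {ι : Type u} {B : ι → Type u} [∀ i, Ring (B i)] [∀ i, Algebra k (B i)]
  (D : DualDecomposition k A B)

open scoped Classical in
/-- The element of `A^*` with component `b` at `i` and zero elsewhere. -/
def single (i : ι) : B i →ₗ[k] DualAlg k A k :=
  D.toPi.symm.toLinearMap ∘ₗ LinearMap.single k B i

open scoped Classical in
theorem toPi_single_eq (i : ι) (b : B i) : D.toPi (D.single i b) = Pi.single i b :=
  D.toPi.apply_symm_apply _

open scoped Classical in
/-- The element of `A` given by a linear form on `B i`. -/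
def coeff (i : ι) (c : Module.Dual k (B i)) : A := D.decomp.symm (DirectSum.lof k ι _ i c)

theorem apply_coeff (f : DualAlg k A k) (i : ι) (c : Module.Dual k (B i)) :
    f (D.coeff i c) = c (D.toPi f i) := by
  classical
  rw [D.pairing, coeff, LinearEquiv.apply_symm_apply]
  exact DirectSum.toModule_lof (N := k) k
    (φ := fun i => Module.Dual.eval k (B i) (D.toPi f i)) i c

theorem mul_single (f : DualAlg k A k) (i : ι) (b : B i) :
    f * D.single i b = D.single i (D.toPi f i * b) := by
  classical
  apply D.toPi.injective
  rw [map_mul, toPi_single_eq, toPi_single_eq, ← Pi.single_mul_right]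

theorem single_mul (f : DualAlg k A k) (i : ι) (b : B i) :
    D.single i b * f = D.single i (b * D.toPi f i) := by
  classical
  apply D.toPi.injective
  rw [map_mul, toPi_single_eq, toPi_single_eq, ← Pi.single_mul_left]

theorem toPi_single (i : ι) (b : B i) : D.toPi (D.single i b) i = b := by
  classical
  rw [toPi_single_eq, Pi.single_eq_same]

theorem incl_lof [DecidableEq ι] (i : ι) (b : B i) :
    D.incl (DirectSum.lof k ι B i b) = D.single i b := by
  apply D.toPi.injective
  rw [toPi_single_eq]
  refine (D.toPi.apply_symm_apply _).trans ?_
  refine (DFinsupp.single_eq_pi_single (i := i) (b := b)).trans ?_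
  congr!

theorem polarity_lof [DecidableEq ι] (i : ι) (b : B i) :
    D.polarity (DirectSum.lof k ι B i b) = D.coeff i (regPolarity k (B i) b) := by
  rw [polarity, coeff, LinearMap.comp_apply, DirectSum.lmap_lof]
  congr!

/-- Pairing with `f` turns this into `tr(b f) = ∑ eʲ(b f eⱼ)`. It writes `φ(b)` through
translations, with which `F` commutes. -/
theorem coeff_regPolarity (i : ι) {J : Type*} [Fintype J] (e : Module.Basis J k (B i)) (b : B i) :
    D.coeff i (regPolarity k (B i) b) =
      ∑ j, ract (D.single i b) (lact (D.single i (e j)) (D.coeff i (e.coord j))) := by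
  refine dual_ext (k := k) fun f => ?_
  rw [map_sum, apply_coeff]
  simp only [apply_ract, apply_lact]
  refine (regTrace_mul_eq_sum e b _).trans (Finset.sum_congr rfl fun j _ => ?_)
  rw [apply_coeff, mul_single, toPi_single, single_mul, toPi_single]

theorem fourier_coeff_regPolarity (hG : IsLinearlyReductive k A) {w : DualAlg k A k}
    (hw : IsInvariantIntegral w) (i : ι) [FiniteDimensional k (B i)] (b : B i) :
    fourier w (D.coeff i (regPolarity k (B i) b)) = D.single i b := by
  let e := Module.finBasis k (B i)
  rw [D.coeff_regPolarity i e, map_sum]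
  simp only [fourier_ract hG hw, fourier_lact hG hw]
  -- The factor `∑ eⱼ * F(cⱼ)` is the unit of the block; the remaining hypothesis is the expansion
  -- of an element of the block in the basis `e`.
  rw [← Finset.sum_mul, sum_mul_fourier hw.normalized _ _ (D.single i 1), single_mul, toPi_single,
    one_mul]
  intro x
  refine dual_ext (k := k) fun f => ?_
  rw [map_sum, apply_ract, single_mul, one_mul]
  simp only [map_smul, apply_coeff]
  conv_rhs => rw [← e.sum_repr (D.toPi f i), map_sum, ofConv_sum, LinearMap.sum_apply]
  simp [mul_comm]

theorem fourier_polarity (hG : IsLinearlyReductive k A) {w : DualAlg k A k}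
    (hw : IsInvariantIntegral w) [∀ i, FiniteDimensional k (B i)] (s : ⨁ i, B i) :
    fourier w (D.polarity s) = D.incl s := by
  classical
  refine DFunLike.congr_fun (f := fourier w ∘ₗ D.polarity) (DirectSum.linearMap_ext k fun i => ?_) s
  ext1 b
  exact (congrArg (fourier w) (D.polarity_lof i b)).trans
    ((D.fourier_coeff_regPolarity hG hw i b).trans (D.incl_lof i b).symm)

theorem incl_injective : Function.Injective D.incl :=
  D.toPi.symm.injective.comp DFunLike.coe_injective

/-- Nondegeneracy of the trace form is a consequence of `F ∘ φ` being the injective inclusion;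
surjectivity then follows from dimensions, block by block. -/
theorem polarity_bijective (hG : IsLinearlyReductive k A) {w : DualAlg k A k}
    (hw : IsInvariantIntegral w) [∀ i, FiniteDimensional k (B i)] :
    Function.Bijective D.polarity := by
  classical
  have hinj : Function.Injective D.polarity := fun s t h => D.incl_injective (by
    rw [← D.fourier_polarity hG hw, h, D.fourier_polarity hG hw])
  refine ⟨hinj, D.decomp.symm.surjective.comp (DirectSum.lmap_surjective _ |>.2 fun i => ?_)⟩
  refine (LinearMap.injective_iff_surjective_of_finrank_eq_finrank
    (Subspace.dual_finrank_eq (K := k) (V := B i)).symm).1 ?_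
  intro a b h
  have : D.polarity (DirectSum.lof k ι B i a) = D.polarity (DirectSum.lof k ι B i b) := by
    rw [polarity_lof, polarity_lof, h]
  exact DFinsupp.single_injective (hinj this)

theorem toPi_incl (s : ⨁ i, B i) : D.toPi (D.incl s) = s := D.toPi.apply_symm_apply _

/-- The product of two elements of `⊕ᵢ Bᵢ`. -/
def mulSum (s t : ⨁ i, B i) : ⨁ i, B i :=
  DFinsupp.zipWith (fun _ x y => x * y) (fun _ => mul_zero 0) s t

theorem mulSum_apply (s t : ⨁ i, B i) (i : ι) : mulSum s t i = s i * t i :=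
  DFinsupp.zipWith_apply _ _ _ _ _

theorem incl_mulSum (s t : ⨁ i, B i) : D.incl (mulSum s t) = D.incl s * D.incl t := by
  apply D.toPi.injective
  rw [map_mul, toPi_incl, toPi_incl, toPi_incl]
  ext i
  exact mulSum_apply s t i

theorem mulSum_lof [DecidableEq ι] (i : ι) (b : B i) (s : ⨁ i, B i) :
    mulSum (DirectSum.lof k ι B i b) s = DirectSum.lof k ι B i (b * s i) := by
  refine DFinsupp.ext fun j => (mulSum_apply _ _ _).trans ?_
  by_cases h : i = j
  · subst h; rw [DirectSum.lof_apply, DirectSum.lof_apply]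
  · rw [DirectSum.lof_eq_of, DirectSum.lof_eq_of, DirectSum.of_eq_of_ne _ _ _ (Ne.symm h),
      DirectSum.of_eq_of_ne _ _ _ (Ne.symm h), zero_mul]

theorem add_mulSum (s t u : ⨁ i, B i) : mulSum (s + t) u = mulSum s u + mulSum t u :=
  DFinsupp.ext fun j => by
    rw [DirectSum.add_apply]
    simp only [mulSum_apply, DirectSum.add_apply, add_mul]

theorem incl_polarity (s t : ⨁ i, B i) : D.incl s (D.polarity t) = D.tr (mulSum t s) := by
  classical
  induction t using DirectSum.induction_on with
  | zero =>
    have : mulSum (0 : ⨁ i, B i) s = 0 :=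
      DFinsupp.ext fun j => (mulSum_apply _ _ _).trans (zero_mul _)
    rw [this, map_zero, map_zero, map_zero]
  | add x y hx hy => rw [map_add, map_add, add_mulSum, map_add, hx, hy]
  | of i b =>
    rw [← DirectSum.lof_eq_of k, polarity_lof, mulSum_lof, apply_coeff, toPi_incl]
    change regTrace k (B i) (b * s i) = _
    rw [tr]
    refine Eq.symm ?_
    convert DirectSum.toModule_lof (N := k) k (φ := fun i => regTrace k (B i)) i (b * s i) using 1

/-- For `a = φ(s)` and `b = φ(t)`, the product `F(a) F(b)` is `s t`, and `w(a^* b) = F(b)(a)` is the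
pairing of `t` with `φ(s)`, that is `tr(s t)`. -/
theorem parseval (hG : IsLinearlyReductive k A) {w : DualAlg k A k}
    (hw : IsInvariantIntegral w) [∀ i, FiniteDimensional k (B i)] :
    (∃ φ : (⨁ i, B i) ≃ₗ[k] A, φ.toLinearMap = D.polarity ∧
      ∀ a : A, fourier w a = D.incl (φ.symm a)) ∧
    ∀ a b : A, ∃ t : ⨁ i, B i, D.incl t = fourier w a * fourier w b ∧
      w (HopfAlgebra.antipode k a * b) = D.tr t := by
  have hbij := D.polarity_bijective hG hw
  refine ⟨⟨LinearEquiv.ofBijective D.polarity hbij, rfl, fun a => ?_⟩, fun a b => ?_⟩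
  · rw [← D.fourier_polarity hG hw]
    exact congrArg (fourier w)
      ((LinearEquiv.ofBijective D.polarity hbij).apply_symm_apply a).symm
  · obtain ⟨s, rfl⟩ := hbij.surjective a
    obtain ⟨t, rfl⟩ := hbij.surjective b
    refine ⟨mulSum s t, ?_, ?_⟩
    · rw [incl_mulSum, D.fourier_polarity hG hw, D.fourier_polarity hG hw]
    · rw [← fourier_apply, fourier_symm hG hw, D.fourier_polarity hG hw, incl_polarity]

end DualDecomposition
end Parseval

/-! ### Decomposition of `A` into simple subcoalgebras. -/

section Decomposition

variable {k A : Type u} [Field k] [CommRing A] [HopfAlgebra k A]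

/-- `A` as a module over the dual algebra, `f • a = ∑ a₁ f(a₂)`. -/
abbrev dualModule : Module (DualAlg k A k) A := Module.compHom A (lact (k := k) (A := A)).toRingHom

attribute [local instance] dualModule

theorem dual_smul_def (f : DualAlg k A k) (a : A) : f • a = lact f a := rfl

theorem isScalarTower_dual : IsScalarTower k (DualAlg k A k) A where
  smul_assoc c f a := by simp [dual_smul_def]

attribute [local instance] isScalarTower_dual

theorem isSemisimpleModule_dual (hG : IsLinearlyReductive k A) :
    IsSemisimpleModule (DualAlg k A k) A := by
  refine (isSemisimpleModule_iff _ _).2 ⟨fun W => ?_⟩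
  obtain ⟨W', hW', hc⟩ := hG A (regular k A) (W.restrictScalars k)
    ((LinRep.isSubrep_iff _ _).2 fun f v hv => W.smul_mem f hv)
  refine ⟨{ W' with smul_mem' := fun f v hv => (LinRep.isSubrep_iff _ _).1 hW' f v hv }, ?_⟩
  rw [isCompl_iff, Submodule.disjoint_def, codisjoint_iff, Submodule.eq_top_iff'] at hc ⊢
  refine ⟨hc.1, fun x => ?_⟩
  obtain ⟨y, hy, z, hz, rfl⟩ := Submodule.mem_sup.1 (hc.2 x)
  exact Submodule.mem_sup.2 ⟨y, hy, z, hz, rfl⟩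

/-- Right translations are exactly the endomorphisms of `A` as a module over the dual algebra. -/
theorem isFullyInvariant_iff_ract (N : Submodule (DualAlg k A k) A) :
    N.IsFullyInvariant ↔ ∀ f : DualAlg k A k, ∀ a ∈ N, ract f a ∈ N := by
  constructor
  · intro h f a ha
    exact h { ract f with map_smul' := fun g x => (lact_ract g f x).symm } ha
  · intro h T a ha
    -- An endomorphism `T` is right translation by `ε ∘ T`, since `g(T a) = ε(g · T a) = ε(T(g ·
    -- a))`.
    let f : DualAlg k A k :=
      toConv (Coalgebra.counit ∘ₗ (T.restrictScalars k : A →ₗ[k] A))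
    have : T a = ract f a := by
      refine dual_ext (k := k) fun g => ?_
      rw [apply_ract, ← apply_lact, ← counit_lact, ← dual_smul_def, ← map_smul]
      rfl
    change T a ∈ N
    rw [this]
    exact h f a ha

/-- A fully invariant submodule is a supremum of isotypic components, and these are independent. -/
theorem eq_bot_or_eq_of_le {c N : Submodule (DualAlg k A k) A}
    [IsSemisimpleModule (DualAlg k A k) A]
    (hc : c ∈ isotypicComponents (DualAlg k A k) A) (hN : N.IsFullyInvariant) (h : N ≤ c) :
    N = ⊥ ∨ N = c := by
  obtain ⟨s, hs, rfl⟩ := isFullyInvariant_iff_sSup_isotypicComponents.1 hN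
  by_cases hcs : c ∈ s
  · exact Or.inr (le_antisymm h (le_sSup hcs))
  · refine Or.inl (sSup_eq_bot.2 fun d hd => ?_)
    have hdis := (sSupIndep_isotypicComponents (DualAlg k A k) A).pairwiseDisjoint (hs hd) hc
      fun hdc => hcs (hdc ▸ hd)
    exact hdis.eq_bot_of_le ((le_sSup hd).trans h)

theorem finiteDimensional_isotypicComponents [IsSemisimpleModule (DualAlg k A k) A]
    (c : isotypicComponents (DualAlg k A k) A) : FiniteDimensional k c.1 := by
  have hc := (isFullyInvariant_iff_ract c.1).1 (.of_mem_isotypicComponents c.2)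
  obtain ⟨a, hac, ha⟩ := Submodule.exists_mem_ne_zero_of_ne_bot (bot_lt_isotypicComponents c.2).ne'
  obtain ⟨U, hU, hUa⟩ := exists_finiteDimensional_biorbit (k := k) a
  -- The elements of `c` whose two-sided orbit stays in `U` form a fully invariant submodule
  -- containing `a ≠ 0`, hence all of `c`; so `c ≤ U`.
  let N : Submodule (DualAlg k A k) A :=
    { carrier := {x | x ∈ c.1 ∧ ∀ f g : DualAlg k A k, lact f (ract g x) ∈ U}
      zero_mem' := ⟨zero_mem _, fun f g => by simp⟩
      add_mem' := fun {x y} hx hy => ⟨add_mem hx.1 hy.1, fun f g => by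
        rw [map_add, map_add]; exact add_mem (hx.2 f g) (hy.2 f g)⟩
      smul_mem' := fun h x hx => ⟨c.1.smul_mem h hx.1, fun f g => by
        rw [dual_smul_def, ← lact_ract, ← Module.End.mul_apply, ← map_mul]
        exact hx.2 _ _⟩ }
  have hN : N.IsFullyInvariant := (isFullyInvariant_iff_ract N).2 fun h x hx =>
    ⟨hc h x hx.1, fun f g => by rw [ract_ract]; exact hx.2 _ _⟩
  have hNc : N = c := (eq_bot_or_eq_of_le c.2 hN fun x hx => hx.1).resolve_left fun h0 => by
    have : a ∈ N := ⟨hac, hUa⟩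
    rw [h0] at this
    exact ha this
  have hcU : c.1.restrictScalars k ≤ U := fun x hx => by
    have hx' : x ∈ N := hNc ▸ hx
    simpa [ract_one] using hx'.2 1 1
  exact Submodule.finiteDimensional_of_le hcU

/-- A subspace of `A` stable under left and right translations, i.e. a subcoalgebra. -/
structure IsSubcoalgebra (C : Submodule k A) : Prop where
  lact_mem : ∀ f : DualAlg k A k, ∀ a ∈ C, lact f a ∈ C
  ract_mem : ∀ f : DualAlg k A k, ∀ a ∈ C, ract f a ∈ C

variable (k A) in
/-- `A` is the direct sum of finite-dimensional simple subcoalgebras. -/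
theorem exists_simple_subcoalgebras (hG : IsLinearlyReductive k A) :
    ∃ (ι : Type u) (C : ι → Submodule k A), (∀ i, IsSubcoalgebra (C i)) ∧
      (∀ i, FiniteDimensional k (C i)) ∧ (∀ i, C i ≠ ⊥) ∧
      (∀ i N, IsSubcoalgebra N → N ≤ C i → N = ⊥ ∨ N = C i) ∧
      iSupIndep C ∧ iSup C = ⊤ := by
  have := isSemisimpleModule_dual hG
  refine ⟨isotypicComponents (DualAlg k A k) A, fun c => c.1.restrictScalars k, fun c =>
    ⟨fun f a ha => c.1.smul_mem f ha, (isFullyInvariant_iff_ract c.1).1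
      (.of_mem_isotypicComponents c.2)⟩, finiteDimensional_isotypicComponents, fun c h => ?_,
    fun c N hN hNc => ?_, ?_, ?_⟩
  · exact (bot_lt_isotypicComponents c.2).ne' ((Submodule.restrictScalars_eq_bot_iff k _ _).1 h)
  · let N' : Submodule (DualAlg k A k) A := { N with smul_mem' := hN.lact_mem }
    refine (eq_bot_or_eq_of_le c.2 ((isFullyInvariant_iff_ract N').2 hN.ract_mem) hNc).imp
      (fun h => ?_) (fun h => ?_)
    · exact (Submodule.restrictScalars_eq_bot_iff k _ _ (p := N')).2 h
    · exact congrArg (Submodule.restrictScalars k) h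
  · intro c
    have h := (sSupIndep_iff _).1 (sSupIndep_isotypicComponents (DualAlg k A k) A) c
    simp only [← Submodule.restrictScalars_iSup]
    rw [Submodule.disjoint_def] at h ⊢
    exact h
  · rw [← Submodule.restrictScalars_iSup, ← sSup_eq_iSup',
      sSup_isotypicComponents (DualAlg k A k) A]
    rfl

end Decomposition

/-! ### The dual algebra of a subcoalgebra. -/

section Block

variable {k A : Type u} [Field k] [CommRing A] [HopfAlgebra k A]

variable {C : Submodule k A}

section

variable (hC : IsSubcoalgebra C)

/-- The left translations of a subcoalgebra. -/
def blockHom : DualAlg k A k →ₐ[k] Module.End k C :=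
  AlgHom.ofLinearMap
    { toFun f := (lact f).restrict (hC.lact_mem f)
      map_add' f g := by ext; simp
      map_smul' c f := by ext; simp }
    (by ext; simp)
    (fun f g => by ext; simp)

/-- The image of the dual algebra in the endomorphisms of a subcoalgebra `C`; it is isomorphic to
the dual of `C`. -/
def Block : Type u := (blockHom hC).range

instance : Ring (Block hC) :=
  @Subalgebra.toRing k (Module.End k C) _ Module.End.instRing _ (blockHom hC).range

instance : Algebra k (Block hC) := Subalgebra.algebra (blockHom hC).range

/-- The action of a block on its subcoalgebra. -/
def blockVal : Block hC →ₗ[k] Module.End k C := (blockHom hC).range.val.toLinearMap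

theorem blockVal_injective : Function.Injective (blockVal hC) := Subtype.val_injective

/-- The projection of the dual algebra onto a block. -/
def toBlock : DualAlg k A k →ₐ[k] Block hC := (blockHom hC).rangeRestrict

/-- The form on `C` defined by an element of its block. -/
def blockForm : Block hC →ₗ[k] Module.Dual k C :=
  LinearMap.compRight k (Coalgebra.counit ∘ₗ C.subtype) ∘ₗ blockVal hC

theorem blockVal_toBlock (f : DualAlg k A k) (x : C) :
    (blockVal hC (toBlock hC f) x : A) = lact f x.1 := rfl

theorem toBlock_surjective : Function.Surjective (toBlock hC) :=
  AlgHom.rangeRestrict_surjective _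

theorem blockForm_toBlock (f : DualAlg k A k) (x : C) :
    blockForm hC (toBlock hC f) x = f x.1 :=
  counit_lact f x.1

/-- If `f` vanishes on `C`, then `g(f · x) = f(x · g) = 0` for all `g`, so `f` acts by zero on `C`.
Conversely, every form on `C` extends to `A`. -/
theorem blockForm_bijective : Function.Bijective (blockForm hC) := by
  constructor
  · rw [injective_iff_map_eq_zero]
    intro b hb
    obtain ⟨f, rfl⟩ := toBlock_surjective hC b
    apply blockVal_injective
    ext x
    rw [blockVal_toBlock]
    refine dual_ext (k := k) fun g => ?_
    have := DFunLike.congr_fun hb ⟨ract g x.1, hC.ract_mem g x.1 x.2⟩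
    rw [blockForm_toBlock] at this
    rw [apply_lact, ← apply_ract]
    refine this.trans ?_
    simp
  · intro h
    obtain ⟨f, hf⟩ := LinearMap.exists_extend h
    refine ⟨toBlock hC (toConv f), ?_⟩
    ext x
    rw [blockForm_toBlock]
    exact DFunLike.congr_fun hf x

end

variable (C) in
/-- A `k`-algebra `B`, which is a quotient of the dual algebra, as the dual of a subcoalgebra. -/
structure DualBlock (B : Type u) [Ring B] [Algebra k B] where
  proj : DualAlg k A k →ₐ[k] B
  proj_surjective : Function.Surjective proj
  form : B ≃ₗ[k] Module.Dual k C
  form_proj : ∀ f (x : C), form (proj f) x = f x.1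

theorem exists_dualBlock (hC : IsSubcoalgebra C) :
    ∃ (B : Type u) (_ : Ring B) (_ : Algebra k B), Nonempty (DualBlock C B) :=
  ⟨Block hC, inferInstance, inferInstance, ⟨toBlock hC, toBlock_surjective hC,
    LinearEquiv.ofBijective (blockForm hC) (blockForm_bijective hC), blockForm_toBlock hC⟩⟩

namespace DualBlock

variable {B : Type u} [Ring B] [Algebra k B]

theorem finiteDimensional (D : DualBlock C B) [FiniteDimensional k C] : FiniteDimensional k B :=
  Module.Finite.equiv D.form.symm

/-- The annihilator in `C` of a two-sided ideal is a subcoalgebra, hence `0` or `C`; by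
finite-dimensional duality the ideal is then everything or zero. -/
theorem isSimpleRing (D : DualBlock C B) (hC : IsSubcoalgebra C)
    [FiniteDimensional k C] (h0 : C ≠ ⊥)
    (h : ∀ N, IsSubcoalgebra N → N ≤ C → N = ⊥ ∨ N = C) : IsSimpleRing B := by
  obtain ⟨a, haC, ha⟩ := Submodule.exists_mem_ne_zero_of_ne_bot h0
  have hn : Nontrivial B := by
    by_contra hB
    rw [not_nontrivial_iff_subsingleton] at hB
    refine ha (dual_ext (k := k) fun f => ?_)
    rw [← D.form_proj f ⟨a, haC⟩, Subsingleton.elim (D.proj f) 0]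
    simp
  refine ⟨⟨fun J => ?_⟩⟩
  let Φ : Submodule k (Module.Dual k C) := Submodule.map D.form.toLinearMap
    { carrier := {b | b ∈ J}
      zero_mem' := J.zero_mem
      add_mem' := J.add_mem
      smul_mem' := fun c b hb => by
        rw [Algebra.smul_def]; exact J.mul_mem_left _ _ hb }
  have hΦ : ∀ f : DualAlg k A k, D.proj f ∈ J → ∀ a ∈ Φ.dualCoannihilator, f a.1 = 0 := by
    intro f hf a ha
    rw [← D.form_proj]
    exact (Submodule.mem_dualCoannihilator _).1 ha _ ⟨_, hf, rfl⟩
  have hΦ' : ∀ a : C, (∀ f : DualAlg k A k, D.proj f ∈ J → f a.1 = 0) →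
      a ∈ Φ.dualCoannihilator := by
    intro a ha
    refine (Submodule.mem_dualCoannihilator _).2 ?_
    rintro _ ⟨b, hb, rfl⟩
    obtain ⟨f, rfl⟩ := D.proj_surjective b
    exact (D.form_proj _ _).trans (ha f hb)
  have hN : IsSubcoalgebra (Φ.dualCoannihilator.map C.subtype) := by
    constructor
    · rintro f _ ⟨a, ha, rfl⟩
      refine ⟨⟨lact f a.1, hC.lact_mem f _ a.2⟩, hΦ' _ fun g hg => ?_, rfl⟩
      rw [apply_lact]
      exact hΦ _ (by rw [map_mul]; exact J.mul_mem_right _ _ hg) a ha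
    · rintro f _ ⟨a, ha, rfl⟩
      refine ⟨⟨ract f a.1, hC.ract_mem f _ a.2⟩, hΦ' _ fun g hg => ?_, rfl⟩
      rw [apply_ract]
      exact hΦ _ (by rw [map_mul]; exact J.mul_mem_left _ _ hg) a ha
  rcases h _ hN (Submodule.map_subtype_le _ _) with h | h
  · right
    replace h : Φ.dualCoannihilator = ⊥ :=
      Submodule.map_injective_of_injective C.subtype_injective (h.trans (Submodule.map_bot _).symm)
    have hT : Φ = ⊤ := by
      rw [← Subspace.dualCoannihilator_dualAnnihilator_eq (W := Φ), h,
        Submodule.dualAnnihilator_bot]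
    obtain ⟨b, hb, hb1⟩ : D.form 1 ∈ Φ := hT ▸ Submodule.mem_top
    refine (TwoSidedIdeal.one_mem_iff _).1 ?_
    rw [← D.form.injective hb1]
    exact hb
  · left
    refine eq_bot_iff.2 fun b hb => ?_
    rw [TwoSidedIdeal.mem_bot]
    apply D.form.injective
    ext x
    obtain ⟨f, rfl⟩ := D.proj_surjective b
    obtain ⟨y, hy, hyx⟩ : x.1 ∈ Φ.dualCoannihilator.map C.subtype := by rw [h]; exact x.2
    rw [D.form_proj, map_zero, ← hyx]
    exact hΦ f hb y hy

end DualBlock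

end Block

/-! ### The dual algebra as a product of blocks. -/

section Product

variable {k A : Type u} [Field k] [CommRing A] [HopfAlgebra k A] {ι : Type u}
  {C : ι → Submodule k A} {B : ι → Type u} [∀ i, Ring (B i)] [∀ i, Algebra k (B i)]

open scoped Classical in
theorem nonempty_dualDecomposition (h : DirectSum.IsInternal C) [∀ i, FiniteDimensional k (C i)]
    (D : ∀ i, DualBlock (C i) (B i)) : Nonempty (DualDecomposition k A B) := by
  let E : (⨁ i, C i) ≃ₗ[k] A := LinearEquiv.ofBijective (DirectSum.coeLinearMap C) h
  -- Biduality followed by the transpose of `B i ≃ (C i)^*`.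
  let θ : ∀ i, C i ≃ₗ[k] Module.Dual k (B i) := fun i =>
    (Module.evalEquiv k (C i)).trans (D i).form.dualMap
  have hθ : ∀ i (x : C i) (f : DualAlg k A k), θ i x ((D i).proj f) = f x.1 :=
    fun i x f => (D i).form_proj f x
  let P : DualAlg k A k →ₐ[k] ∀ i, B i := AlgHom.pi fun i => (D i).proj
  have hE : ∀ i (x : C i), E (DirectSum.lof k ι _ i x) = x.1 := fun i x =>
    DirectSum.coeLinearMap_lof C i x
  have hext : ∀ f g : DualAlg k A k, (∀ i, ∀ x : C i, f x.1 = g x.1) → f = g := by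
    intro f g hfg
    have : f.ofConv ∘ₗ E.toLinearMap = g.ofConv ∘ₗ E.toLinearMap := by
      refine DirectSum.linearMap_ext k fun i => ?_
      ext x
      simpa [hE] using hfg i x
    ext a
    simpa using DFunLike.congr_fun this (E.symm a)
  have hP : Function.Bijective P := by
    constructor
    · intro f g hfg
      refine hext f g fun i x => ?_
      rw [← hθ, ← hθ]
      exact congrArg _ (congrFun hfg i)
    · intro b
      choose f hf using fun i => (D i).proj_surjective (b i)
      let F : DualAlg k A k := toConv (DirectSum.toModule k ι k
        (fun i => (f i).ofConv ∘ₗ (C i).subtype) ∘ₗ E.symm.toLinearMap)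
      have hF : ∀ i (x : C i), F x.1 = f i x.1 := fun i x => by
        change DirectSum.toModule k ι k (fun i => (f i).ofConv ∘ₗ (C i).subtype) (E.symm x.1) = _
        rw [← hE, LinearEquiv.symm_apply_apply, DirectSum.toModule_lof, hE]
        rfl
      refine ⟨F, funext fun i => ?_⟩
      rw [← hf]
      apply (D i).form.injective
      ext x
      exact ((D i).form_proj _ _).trans ((hF i x).trans ((D i).form_proj _ _).symm)
  refine ⟨⟨E.symm.trans (DFinsupp.mapRange.linearEquiv θ), AlgEquiv.ofBijective P hP,
    fun f a => ?_⟩⟩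
  obtain ⟨x, rfl⟩ := E.surjective a
  rw [LinearEquiv.trans_apply, LinearEquiv.symm_apply_apply]
  induction x using DirectSum.induction_on with
  | zero => simp
  | add x y hx hy => simp only [map_add, hx, hy]
  | of i x =>
    rw [← DirectSum.lof_eq_of k, hE]
    have : DFinsupp.mapRange.linearEquiv θ (DirectSum.lof k ι _ i x) =
        DirectSum.lof k ι _ i (θ i x) := DFinsupp.mapRange_single (hf := fun i => map_zero (θ i))
    rw [this, DirectSum.toModule_lof]
    exact (hθ i x f).symm

variable (k A) in
/-- The dual algebra of a linearly reductive group is a product of finite simple algebras. -/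
theorem exists_dualDecomposition (hG : IsLinearlyReductive k A) :
    ∃ (ι : Type u) (B : ι → Type u) (_ : ∀ i, Ring (B i)) (_ : ∀ i, Algebra k (B i)),
      (∀ i, FiniteDimensional k (B i)) ∧ (∀ i, IsSimpleRing (B i)) ∧
      Nonempty (DualDecomposition k A B) := by
  classical
  obtain ⟨ι, C, hC, hfin, h0, hs, hind, htop⟩ := exists_simple_subcoalgebras k A hG
  choose B hR hA hD using fun i => exists_dualBlock (hC i)
  let D := fun i => (hD i).some
  exact ⟨ι, B, hR, hA, fun i => (D i).finiteDimensional,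
    fun i => (D i).isSimpleRing (hC i) (h0 i) (hs i),
    nonempty_dualDecomposition
      (DirectSum.isInternal_submodule_of_iSupIndep_of_iSup_eq_top hind htop) D⟩

end Product

/-! ### Schur's lemma and orthonormality of characters. -/

section Characters

variable {k A : Type u} [Field k] [CommRing A] [HopfAlgebra k A]

namespace LinRep

variable {V V' : Type u} [AddCommGroup V] [Module k V] [AddCommGroup V'] [Module k V']

/-- The orbit of a nonzero vector is a subrepresentation, hence everything, and orbits are
finite-dimensional. -/
theorem IsIrreducible.finiteDimensional {ρ : LinRep k A V} (h : ρ.IsIrreducible) :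
    FiniteDimensional k V := by
  obtain ⟨hn, h⟩ := h
  obtain ⟨v, hv⟩ := exists_ne (0 : V)
  obtain ⟨U, hU, hvU⟩ := ρ.exists_finiteDimensional_orbit v
  let O : Submodule k V := LinearMap.range (ρ.dualAct.toLinearMap.flip v)
  have hO : O = ⊤ := by
    refine (h O ((ρ.isSubrep_iff O).2 ?_)).resolve_left fun h0 => hv ?_
    · rintro f _ ⟨g, rfl⟩
      exact ⟨f * g, by simp⟩
    · have : v ∈ O := ⟨1, by simp⟩
      rwa [h0, Submodule.mem_bot] at this
  have hUt : U = ⊤ := by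
    rw [eq_top_iff, ← hO]
    rintro _ ⟨f, rfl⟩
    exact hvU f
  subst hUt
  exact Module.Finite.equiv (Submodule.topEquiv (R := k) (M := V))

/-- The matrix coefficient `g ↦ φ(g v)`. -/
def matrixCoeff (ρ : LinRep k A V) (φ : Module.Dual k V) : V →ₗ[k] A :=
  (TensorProduct.lid k A).toLinearMap ∘ₗ φ.rTensor A ∘ₗ ρ.coact

theorem apply_matrixCoeff (ρ : LinRep k A V) (φ : Module.Dual k V) (v : V) (f : DualAlg k A k) :
    f (ρ.matrixCoeff φ v) = φ (ρ.dualAct f v) := by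
  rw [dualAct_apply, matrixCoeff, LinearMap.comp_apply, LinearMap.comp_apply]
  generalize ρ.coact v = x
  induction x using TensorProduct.induction_on with
  | zero => simp
  | add x y hx hy => simp only [map_add, hx, hy]
  | tmul u v => simp [mul_comm]

theorem matrixCoeff_dualAct (ρ : LinRep k A V) (φ : Module.Dual k V) (v : V)
    (f : DualAlg k A k) : ρ.matrixCoeff φ (ρ.dualAct f v) = lact f (ρ.matrixCoeff φ v) := by
  refine dual_ext (k := k) fun g => ?_
  rw [apply_lact, apply_matrixCoeff, apply_matrixCoeff, map_mul]
  rfl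

theorem comul_matrixCoeff (ρ : LinRep k A V) {J : Type*} [Fintype J] (e : Module.Basis J k V)
    (φ : Module.Dual k V) (v : V) :
    Coalgebra.comul (R := k) (ρ.matrixCoeff φ v) =
      ∑ j, ρ.matrixCoeff φ (e j) ⊗ₜ ρ.matrixCoeff (e.coord j) v := by
  refine tensor_ext fun f => ?_
  rw [← lact_apply (toConv f), ← matrixCoeff_dualAct, ← e.sum_repr (ρ.dualAct (toConv f) v)]
  simp only [map_sum, map_smul, LinearMap.lTensor_tmul, TensorProduct.rid_tmul]
  refine Finset.sum_congr rfl fun j _ => ?_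
  congr 1
  exact (ρ.apply_matrixCoeff (e.coord j) v (toConv f)).symm

theorem character_eq_sum (ρ : LinRep k A V) {J : Type*} [Fintype J] (e : Module.Basis J k V) :
    ρ.character = ∑ j, ρ.matrixCoeff (e.coord j) (e j) := by
  classical
  rw [character, LinearMap.trace_eq_matrix_trace A (e.baseChange A), Matrix.trace]
  refine Finset.sum_congr rfl fun j _ => ?_
  simp only [Matrix.diag_apply, LinearMap.toMatrix_apply, act, Module.Basis.baseChange_apply,
    LinearMap.liftBaseChange_tmul, one_smul, LinearMap.comp_apply, LinearEquiv.coe_coe,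
    matrixCoeff]
  generalize ρ.coact (e j) = x
  induction x using TensorProduct.induction_on with
  | zero => simp
  | add x y hx hy => simp only [map_add, Finsupp.add_apply, hx, hy]
  | tmul u v => simp [Algebra.smul_def, mul_comm]

theorem IsIso.character_eq {ρ : LinRep k A V} {ρ' : LinRep k A V'} [FiniteDimensional k V]
    (h : ρ.IsIso ρ') : ρ.character = ρ'.character := by
  obtain ⟨e, he⟩ := h
  let b := Module.finBasis k V
  rw [ρ.character_eq_sum b, ρ'.character_eq_sum (b.map e)]
  refine Finset.sum_congr rfl fun j _ => ?_
  have h := DFunLike.congr_fun he (b j)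
  simp only [LinearMap.comp_apply, LinearEquiv.coe_coe] at h
  simp only [matrixCoeff, LinearMap.comp_apply, LinearEquiv.coe_coe, Module.Basis.map_apply, h,
    ← LinearMap.rTensor_comp_apply]
  congr 3
  ext v
  simp

variable {w : DualAlg k A k}

/-- The average of the linear map `v ↦ φ(v) v'`, which intertwines the two representations. -/
def average (w : DualAlg k A k) (ρ : LinRep k A V) (ρ' : LinRep k A V') (φ : Module.Dual k V)
    (v' : V') : V →ₗ[k] V' :=
  (ρ'.dualAct.toLinearMap.flip v') ∘ₗ fourier w ∘ₗ ρ.matrixCoeff φ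

theorem average_apply (ρ : LinRep k A V) (ρ' : LinRep k A V') (φ : Module.Dual k V) (v' : V')
    (v : V) : average w ρ ρ' φ v' v = ρ'.dualAct (fourier w (ρ.matrixCoeff φ v)) v' := rfl

/-- Integrals of products of matrix coefficients, and so of characters, become matrix entries of
intertwining operators. -/
theorem coord_average (ρ : LinRep k A V) (ρ' : LinRep k A V') (φ : Module.Dual k V) (v' : V')
    (φ' : Module.Dual k V') (v : V) : φ' (average w ρ ρ' φ v' v) =
      fourier w (ρ.matrixCoeff φ v) (ρ'.matrixCoeff φ' v') := by
  rw [average_apply, ← apply_matrixCoeff]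

theorem average_dualAct (hG : IsLinearlyReductive k A) (hw : IsInvariantIntegral w)
    (ρ : LinRep k A V) (ρ' : LinRep k A V') (φ : Module.Dual k V) (v' : V') (f : DualAlg k A k)
    (v : V) : average w ρ ρ' φ v' (ρ.dualAct f v) = ρ'.dualAct f (average w ρ ρ' φ v' v) := by
  rw [average_apply, matrixCoeff_dualAct, fourier_lact hG hw, map_mul]
  rfl

/-- Schur's lemma. -/
theorem eq_zero_or_bijective {ρ : LinRep k A V} {ρ' : LinRep k A V'} (h : ρ.IsIrreducible)
    (h' : ρ'.IsIrreducible) (T : V →ₗ[k] V')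
    (hT : ∀ f v, T (ρ.dualAct f v) = ρ'.dualAct f (T v)) : T = 0 ∨ Function.Bijective T := by
  rcases h.2 (LinearMap.ker T) ((ρ.isSubrep_iff _).2 fun f v hv => by
    rw [LinearMap.mem_ker] at hv ⊢; rw [hT, hv, map_zero]) with hk | hk
  · rcases h'.2 (LinearMap.range T) ((ρ'.isSubrep_iff _).2 (by
      rintro f _ ⟨v, rfl⟩; exact ⟨_, hT f v⟩)) with hr | hr
    · exact Or.inl (LinearMap.range_eq_bot.1 hr)
    · exact Or.inr ⟨LinearMap.ker_eq_bot.1 hk, LinearMap.range_eq_top.1 hr⟩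
  · exact Or.inl (LinearMap.ker_eq_top.1 hk)

theorem exists_eq_smul_id [IsAlgClosed k] {ρ : LinRep k A V} (h : ρ.IsIrreducible)
    (T : V →ₗ[k] V) (hT : ∀ f v, T (ρ.dualAct f v) = ρ.dualAct f (T v)) :
    ∃ c : k, T = c • LinearMap.id := by
  have := h.finiteDimensional
  have := h.1
  obtain ⟨c, hc⟩ := Module.End.exists_eigenvalue (K := k) T
  obtain ⟨v, hv⟩ := hc.exists_hasEigenvector
  refine ⟨c, sub_eq_zero.1 ?_⟩
  refine (eq_zero_or_bijective h h (T - c • LinearMap.id) fun f v => ?_).resolve_right fun hb => ?_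
  · simp [hT]
  · refine hv.2 (hb.1 ?_)
    simp [hv.apply_eq_smul]

theorem integral_character_of_not_isIso (hG : IsLinearlyReductive k A)
    (hw : IsInvariantIntegral w) {ρ : LinRep k A V} {ρ' : LinRep k A V'} (h : ρ.IsIrreducible)
    (h' : ρ'.IsIrreducible) (hn : ¬ ρ.IsIso ρ') :
    w (HopfAlgebra.antipode k ρ.character * ρ'.character) = 0 := by
  have := h.finiteDimensional
  have := h'.finiteDimensional
  let b := Module.finBasis k V
  let b' := Module.finBasis k V'
  rw [← fourier_apply, ρ.character_eq_sum b, ρ'.character_eq_sum b', map_sum (fourier w),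
    ofConv_sum, LinearMap.sum_apply]
  refine Finset.sum_eq_zero fun i _ => ?_
  rw [map_sum]
  refine Finset.sum_eq_zero fun j _ => ?_
  rw [← coord_average]
  have hT := average_dualAct hG hw ρ ρ' (b.coord i) (b' j)
  rcases eq_zero_or_bijective h h' _ hT with h0 | hb
  · rw [h0]; simp
  · refine absurd ⟨LinearEquiv.ofBijective _ hb, ?_⟩ hn
    exact ρ.coact_comp_eq ρ' _ hT

/-- The left side is the trace of the average, and equals `ε` of the matrix coefficient by
`lift_metric_comul`. -/
theorem trace_average {J : Type*} [Fintype J] (e : Module.Basis J k V) (hw : w 1 = 1)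
    (ρ : LinRep k A V) (φ : Module.Dual k V) (v : V) :
    ∑ j, e.coord j (average w ρ ρ φ v (e j)) = φ v := by
  have h := lift_metric_comul w (ρ.matrixCoeff φ v)
  rw [hw, mul_one, ρ.comul_matrixCoeff e] at h
  simp only [coord_average]
  simp only [map_sum, TensorProduct.lift.tmul] at h
  refine h.trans ((ρ.apply_matrixCoeff φ v 1).trans ?_)
  rw [map_one]; rfl

theorem integral_character_self [IsAlgClosed k] (hG : IsLinearlyReductive k A)
    (hw : IsInvariantIntegral w) {ρ : LinRep k A V} (h : ρ.IsIrreducible) :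
    w (HopfAlgebra.antipode k ρ.character * ρ.character) = 1 := by
  have := h.finiteDimensional
  have := h.1
  let b := Module.finBasis k V
  have hc : ∀ φ v, ∃ c : k, average w ρ ρ φ v = c • LinearMap.id := fun φ v =>
    exists_eq_smul_id h _ (average_dualAct hG hw ρ ρ φ v)
  choose c hc using hc
  have htr : ∀ φ v, (Module.finrank k V : k) * c φ v = φ v := fun φ v => by
    rw [← trace_average b hw.normalized ρ φ v, hc]
    simp
  rw [← fourier_apply, ρ.character_eq_sum b, map_sum (fourier w), ofConv_sum, LinearMap.sum_apply]
  simp only [map_sum, ← coord_average, hc]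
  have hdiag : ∀ i, (Module.finrank k V : k) * c (b.coord i) (b i) = 1 := fun i => by
    rw [htr]; simp
  -- The trace relation itself forces `dim V` to be invertible in `k`. In the double sum only the
  -- `dim V` diagonal terms survive, each equal to `1 / dim V`.
  have hn : (Module.finrank k V : k) ≠ 0 := fun h0 => by
    have := hdiag ⟨0, Module.finrank_pos⟩
    rw [h0, zero_mul] at this
    exact zero_ne_one this
  have hci : ∀ i, c (b.coord i) (b i) = (Module.finrank k V : k)⁻¹ := fun i =>
    eq_inv_of_mul_eq_one_right (hdiag i)
  simp [Finsupp.single_apply, hci, hn]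

end LinRep
end Characters

end AffineGroup

end

open AffineGroup in
theorem mainTheorem1 (k A : Type u) [Field k] [CommRing A] [HopfAlgebra k A]
    (hG : IsLinearlyReductive k A) :
    -- the invariant integral exists and is unique
    (∃! w : DualAlg k A k, IsInvariantIntegral w) ∧
    -- the dual algebra is a product of finite simple algebras
    (∃ (ι : Type u) (B : ι → Type u) (_ : ∀ i, Ring (B i)) (_ : ∀ i, Algebra k (B i)),
      (∀ i, FiniteDimensional k (B i)) ∧ (∀ i, IsSimpleRing (B i)) ∧
      Nonempty (DualDecomposition k A B)) ∧
    ∀ w : DualAlg k A k, IsInvariantIntegral w →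
      -- the Fourier transform is a morphism of left and right `G`-modules
      (∀ (R : Type u) [CommRing R] [Algebra k R] (g : A →ₐ[k] R) (x : R ⊗[k] A),
        fourierExt w R (leftTranslate g x) = point g * fourierExt w R x ∧
        fourierExt w R (rightTranslate g x) = fourierExt w R x * point g) ∧
      -- it is the inverse of the polarity, and Parseval's identity holds
      (∀ (ι : Type u) (B : ι → Type u) [∀ i, Ring (B i)] [∀ i, Algebra k (B i)]
        [∀ i, FiniteDimensional k (B i)] [∀ i, IsSimpleRing (B i)]
        (D : DualDecomposition k A B),
        (∃ φ : (⨁ i, B i) ≃ₗ[k] A, φ.toLinearMap = D.polarity ∧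
          ∀ a : A, fourier w a = D.incl (φ.symm a)) ∧
        ∀ a b : A, ∃ t : ⨁ i, B i, D.incl t = fourier w a * fourier w b ∧
          w (HopfAlgebra.antipode k a * b) = D.tr t) ∧
      -- orthonormality of the irreducible characters
      (IsAlgClosed k →
        ∀ (V V' : Type u) [AddCommGroup V] [Module k V] [AddCommGroup V'] [Module k V']
          (ρ : LinRep k A V) (ρ' : LinRep k A V'), ρ.IsIrreducible → ρ'.IsIrreducible →
          (ρ.IsIso ρ' → w (HopfAlgebra.antipode k ρ.character * ρ'.character) = 1) ∧
          (¬ ρ.IsIso ρ' → w (HopfAlgebra.antipode k ρ.character * ρ'.character) = 0)) := by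
  refine ⟨existsUnique_integral hG, exists_dualDecomposition k A hG, fun w hw => ⟨?_, ?_, ?_⟩⟩
  · exact fun R _ _ g x =>
      ⟨fourierExt_leftTranslate hG hw g x, fourierExt_rightTranslate hG hw g x⟩
  · exact fun ι B _ _ _ _ D => D.parseval hG hw
  · intro _ V V' _ _ _ _ ρ ρ' h h'
    have := h.finiteDimensional
    refine ⟨fun hiso => ?_, LinRep.integral_character_of_not_isIso hG hw h h'⟩
    rw [← hiso.character_eq]
    exact LinRep.integral_character_self hG hw h
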